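/- **Theorem 4.2 (hyperbolicity of the full 3D modified 13-moment system).** Indices run over $1,2,3$, repeated indices are summed, and parentheses around indices denote symmetrization over the enclosed indices (the average over all their permutations; a derivative index is never symmetrized unless enclosed). Consider the states $$w=(\rho,u_1,u_2,u_3,\theta_{11},\theta_{22},\theta_{33},\theta_{12},\theta_{13},\theta_{23},s_1,s_2,s_3)^T\in\mathbb R^{13}$$ with $\rho>0$ and with $\Theta=(\theta_{ij})$ symmetric positive definite. Write $\theta^{ij}$ for the entries of $\Theta^{-1}$ and $\partial_l=\partial/\partial x_l$, $\frac{d}{dt}=\partial_t+u_k\partial_k$. The modified 13-moment system, i.e. the moment system closed by the phase density $\big[1+\frac{2}{5\rho}s^T\Theta^{-1}C(\frac12C^T\Theta^{-1}C-\frac52)\big]f_G$ with $C=\xi-u$ and $f_G$ the Gaussian of density $\rho$, mean $u$ and covariance $\Theta$, reads $$\frac{d\rho}{dt}+\rho\,\partial_ku_k=0,\qquad \frac{du_i}{dt}+\frac{\theta_{ik}}{\rho}\partial_k\rho+\partial_k\theta_{ik}=0,$$ $$\frac{d\theta_{ij}}{dt}+2\theta_{k(i}\partial_ku_{j)}+\frac{6}{5\rho}G_{ijk,k}=Q_{ij},$$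 $$\begin{aligned}\frac{ds_j}{dt}&-\frac65\theta^{ik}\theta_{l(i}s_j\partial_lu_{k)}-\frac{18}{25\rho}\theta^{ik}s_{(i}G_{jk)l,l}+\frac12\left(\rho\,\theta^{ik}\theta_{jl}\partial_l\theta_{ik}+2\rho\,\partial_l\theta_{jl}\right)\\&+\frac25\left(7s_{(j}\partial_lu_{l)}+\theta^{ik}\theta_{jl}s_{(i}\partial_lu_{k)}\right)=Q_j.\end{aligned}$$ Here $G_{ijk,l}=s_{(i}\,\partial_l\theta_{jk)}+\theta_{(ij}\,\partial_ls_{k)}=\partial_l\big(s_{(i}\theta_{jk)}\big)$; the symmetrization in $s_{(i}G_{jk)l,l}$ is over $i,j,k$ only; the symmetrization in $7s_{(j}\partial_lu_{l)}$ is over $j$ and the index of $u$, so that $s_{(j}\partial_lu_{l)}=\frac12(s_j\partial_lu_l+s_l\partial_lu_j)$; and the collision terms $Q_{ij},Q_j$ contain no derivatives. Let $\tilde M_1,\tilde M_2,\tilde M_3$ be the $13\times13$ coefficient matrices of the quasi-linear form $\partial_tw+\tilde M_k(w)\,\partial_kw=\tilde Q(w)$. Then there is a constant $\delta>0$ such that,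 for every such state $w$ with $\rho^{-2}s^T\Theta^{-1}s<\delta$, the system is hyperbolic at $w$: for every unit vector $n\in\mathbb R^3$ the matrix $n_k\tilde M_k(w)$ is real diagonalizable, i.e. similar over $\mathbb R$ to a real diagonal matrix. -/

import Mathlib

open scoped Matrix

noncomputable section

namespace ThirteenMoment

/-- A real square matrix is real diagonalizable if it is similar, over `ℝ`, to a diagonal matrix. -/
def RealDiagonalizable {n : Type} [Fintype n] [DecidableEq n] (A : Matrix n n ℝ) : Prop :=
  ∃ (P : Matrix n n ℝ) (d : n → ℝ), IsUnit P.det ∧ A = P * Matrix.diagonal d * P⁻¹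

/-- The first-order system `∂w/∂t + A k ∂w/∂x_k = Q` with frozen coefficient matrices
`A 0, A 1, A 2` is hyperbolic if `∑ k, n k • A k` is real diagonalizable for every unit
vector `n` of `ℝ³`. -/
def IsHyperbolic {n : Type} [Fintype n] [DecidableEq n] (A : Fin 3 → Matrix n n ℝ) : Prop :=
  ∀ e : EuclideanSpace ℝ (Fin 3), ‖e‖ = 1 → RealDiagonalizable (∑ k, e k • A k)

/-- Symmetrization of a tensor of order two: `sym2 F i j` is `F_{(ij)}`. -/
def sym2 (F : Fin 3 → Fin 3 → ℝ) (i j : Fin 3) : ℝ :=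
  (F i j + F j i) / 2

/-- Symmetrization of a tensor of order three: `sym3 F i j k` is `F_{(ijk)}`. -/
def sym3 (F : Fin 3 → Fin 3 → Fin 3 → ℝ) (i j k : Fin 3) : ℝ :=
  (F i j k + F i k j + F j i k + F j k i + F k i j + F k j i) / 6

/-- A state is the vector `w = (ρ, u₁, u₂, u₃, θ₁₁, θ₂₂, θ₃₃, θ₁₂, θ₁₃, θ₂₃, s₁, s₂, s₃)`. -/
abbrev State : Type := Fin 13 → ℝ

/-- The component `ρ`. It is linear in the state, so that it also reads off the derivative
of the density from the derivative of a state; likewise for the other components. -/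
def dens (w : State) : ℝ := w 0

/-- The velocity `u`. -/
def vel (w : State) : Fin 3 → ℝ := ![w 1, w 2, w 3]

/-- The symmetric temperature tensor `Θ = (θ_{ij})`. -/
def temp (w : State) : Matrix (Fin 3) (Fin 3) ℝ :=
  !![w 4, w 7, w 8;
     w 7, w 5, w 9;
     w 8, w 9, w 6]

/-- The vector `s`. -/
def svec (w : State) : Fin 3 → ℝ := ![w 10, w 11, w 12]

/-- The symmetric tensor `s_{(i} ∂θ_{jk)} + θ_{(ij} ∂s_{k)}`, where `∂w` is a (partial)
derivative of the state `w`; it is the derivative of `s_{(i} θ_{jk)}`. -/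
def flux3 (w dw : State) (i j k : Fin 3) : ℝ :=
  sym3 (fun a b c => svec w a * temp dw b c) i j k +
    sym3 (fun a b c => temp w a b * svec dw c) i j k

/-! In the next definitions `w` is the state and `D k = ∂w/∂x_k` its spatial derivatives at a
point. They are the spatial-derivative terms, on the left-hand side, of the equations for
`∂ρ/∂t`, `∂u_i/∂t`, `∂θ_{ij}/∂t`, `∂s_j/∂t`; the first sum of each is the part
`u_k ∂/∂x_k` of the material derivative. -/

/-- `u_k ∂_k ρ + ρ ∂_k u_k`. -/
def convDens (w : State) (D : Fin 3 → State) : ℝ :=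
  (∑ k, vel w k * dens (D k)) + dens w * ∑ k, vel (D k) k

/-- `u_k ∂_k u_i + (θ_{ik} / ρ) ∂_k ρ + ∂_k θ_{ik}`. -/
def convVel (w : State) (D : Fin 3 → State) (i : Fin 3) : ℝ :=
  (∑ k, vel w k * vel (D k) i) +
    (∑ k, temp w i k / dens w * dens (D k)) + ∑ k, temp (D k) i k

/-- `u_k ∂_k θ_{ij} + 2 θ_{k(i} ∂_k u_{j)}
  + (6 / (5ρ)) (s_{(i} ∂_k θ_{jk)} + θ_{(ij} ∂_k s_{k)})`. -/
def convTemp (w : State) (D : Fin 3 → State) (i j : Fin 3) : ℝ :=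
  (∑ k, vel w k * temp (D k) i j) +
    2 * (∑ k, sym2 (fun a b => temp w k a * vel (D k) b) i j) +
    6 / (5 * dens w) * ∑ k, flux3 w (D k) i j k

/-- With `θ^{ik}` the entries of `Θ⁻¹` and the tensor
`G_{bcl} = s_{(b} ∂_l θ_{cl)} + θ_{(bc} ∂_l s_{l)}`, symmetrized over `b`, `c`, `l`
before the sum over `l`:
`u_k ∂_k s_j - (6/5) θ^{ik} θ_{l(i} s_j ∂_l u_{k)} - (18 / (25ρ)) θ^{ik} s_{(i} G_{jk)l}
  + (1/2) (ρ θ^{ik} θ_{jl} ∂_l θ_{ik} + 2 ρ ∂_l θ_{jl})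
  + (2/5) (7 s_{(j} ∂_l u_{l)} + θ^{ik} θ_{jl} s_{(i} ∂_l u_{k)})`,
where `s_{(i} G_{jk)l}` is symmetrized over `i`, `j`, `k` only. -/
def convS (w : State) (D : Fin 3 → State) (j : Fin 3) : ℝ :=
  (∑ k, vel w k * svec (D k) j) -
    6 / 5 * (∑ i, ∑ k, ∑ l, (temp w)⁻¹ i k *
      sym3 (fun a b c => temp w l a * svec w b * vel (D l) c) i j k) -
    18 / (25 * dens w) * (∑ i, ∑ k, ∑ l, (temp w)⁻¹ i k *
      sym3 (fun a b c => svec w a * flux3 w (D l) b c l) i j k) +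
    1 / 2 * ((∑ i, ∑ k, ∑ l, dens w * (temp w)⁻¹ i k * temp w j l * temp (D l) i k) +
      2 * dens w * ∑ l, temp (D l) j l) +
    2 / 5 * (7 * (∑ l, sym2 (fun a b => svec w a * vel (D l) b) j l) +
      ∑ i, ∑ k, ∑ l, (temp w)⁻¹ i k * temp w j l *
        sym2 (fun a b => svec w a * vel (D l) b) i k)

/-- All spatial-derivative terms of the modified 13-moment system, in the order of the
components of the state. The system is `∂w/∂t + convection w (∂w/∂x₁, ∂w/∂x₂, ∂w/∂x₃) = Q w`
with a collision term `Q` free of derivatives. -/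
def convection (w : State) (D : Fin 3 → State) : State :=
  ![convDens w D,
    convVel w D 0, convVel w D 1, convVel w D 2,
    convTemp w D 0 0, convTemp w D 1 1, convTemp w D 2 2,
    convTemp w D 0 1, convTemp w D 0 2, convTemp w D 1 2,
    convS w D 0, convS w D 1, convS w D 2]

/-- The coefficient matrix of `∂w/∂x_k` in the quasi-linear form of the system: its entry
`(a, b)` is the coefficient of `∂w_b/∂x_k` in the `a`-th equation. -/
def coeffMatrix (w : State) (k : Fin 3) : Matrix (Fin 13) (Fin 13) ℝ :=
  Matrix.of fun a b => convection w (Pi.single k (Pi.single b 1)) a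

theorem dens_lin (c : ℝ) (v w : State) : dens (c • v + w) = c * dens v + dens w := rfl

theorem vel_lin (c : ℝ) (v w : State) (i : Fin 3) :
    vel (c • v + w) i = c * vel v i + vel w i := by
  fin_cases i <;> rfl

theorem temp_lin (c : ℝ) (v w : State) (i j : Fin 3) :
    temp (c • v + w) i j = c * temp v i j + temp w i j := by
  fin_cases i <;> fin_cases j <;> rfl

theorem svec_lin (c : ℝ) (v w : State) (i : Fin 3) :
    svec (c • v + w) i = c * svec v i + svec w i := by
  fin_cases i <;> rfl

theorem flux3_lin (c : ℝ) (w v v' : State) (i j k : Fin 3) :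
    flux3 w (c • v + v') i j k = c * flux3 w v i j k + flux3 w v' i j k := by
  simp only [flux3, sym3, temp_lin, svec_lin]
  ring

theorem convDens_lin (w : State) (c : ℝ) (D E : Fin 3 → State) :
    convDens w (c • D + E) = c * convDens w D + convDens w E := by
  simp only [convDens, Pi.add_apply, Pi.smul_apply, dens_lin, vel_lin, Fin.sum_univ_three]
  ring

theorem convVel_lin (w : State) (c : ℝ) (D E : Fin 3 → State) (i : Fin 3) :
    convVel w (c • D + E) i = c * convVel w D i + convVel w E i := by
  simp only [convVel, Pi.add_apply, Pi.smul_apply, dens_lin, vel_lin, temp_lin,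
    Fin.sum_univ_three]
  ring

theorem convTemp_lin (w : State) (c : ℝ) (D E : Fin 3 → State) (i j : Fin 3) :
    convTemp w (c • D + E) i j = c * convTemp w D i j + convTemp w E i j := by
  simp only [convTemp, sym2, Pi.add_apply, Pi.smul_apply, vel_lin, temp_lin, flux3_lin,
    Fin.sum_univ_three]
  ring

theorem sum3_lin (c : ℝ) (F G H : Fin 3 → Fin 3 → Fin 3 → ℝ)
    (h : ∀ i k l, F i k l = c * G i k l + H i k l) :
    ∑ i, ∑ k, ∑ l, F i k l = c * (∑ i, ∑ k, ∑ l, G i k l) + ∑ i, ∑ k, ∑ l, H i k l := by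
  simp only [h, Finset.sum_add_distrib, Finset.mul_sum]

theorem convS_lin (w : State) (c : ℝ) (D E : Fin 3 → State) (j : Fin 3) :
    convS w (c • D + E) j = c * convS w D j + convS w E j := by
  have h1 := sum3_lin c
    (fun i k l => (temp w)⁻¹ i k *
      sym3 (fun a b d => temp w l a * svec w b * vel ((c • D + E) l) d) i j k)
    (fun i k l => (temp w)⁻¹ i k *
      sym3 (fun a b d => temp w l a * svec w b * vel (D l) d) i j k)
    (fun i k l => (temp w)⁻¹ i k *
      sym3 (fun a b d => temp w l a * svec w b * vel (E l) d) i j k)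
    (fun i k l => by
      simp only [sym3, Pi.add_apply, Pi.smul_apply, vel_lin]; ring)
  have h2 := sum3_lin c
    (fun i k l => (temp w)⁻¹ i k *
      sym3 (fun a b d => svec w a * flux3 w ((c • D + E) l) b d l) i j k)
    (fun i k l => (temp w)⁻¹ i k *
      sym3 (fun a b d => svec w a * flux3 w (D l) b d l) i j k)
    (fun i k l => (temp w)⁻¹ i k *
      sym3 (fun a b d => svec w a * flux3 w (E l) b d l) i j k)
    (fun i k l => by
      simp only [sym3, Pi.add_apply, Pi.smul_apply, flux3_lin]; ring)
  have h3 := sum3_lin c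
    (fun i k l => dens w * (temp w)⁻¹ i k * temp w j l * temp ((c • D + E) l) i k)
    (fun i k l => dens w * (temp w)⁻¹ i k * temp w j l * temp (D l) i k)
    (fun i k l => dens w * (temp w)⁻¹ i k * temp w j l * temp (E l) i k)
    (fun i k l => by
      simp only [Pi.add_apply, Pi.smul_apply, temp_lin]; ring)
  have h4 := sum3_lin c
    (fun i k l => (temp w)⁻¹ i k * temp w j l *
      sym2 (fun a b => svec w a * vel ((c • D + E) l) b) i k)
    (fun i k l => (temp w)⁻¹ i k * temp w j l *
      sym2 (fun a b => svec w a * vel (D l) b) i k)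
    (fun i k l => (temp w)⁻¹ i k * temp w j l *
      sym2 (fun a b => svec w a * vel (E l) b) i k)
    (fun i k l => by
      simp only [sym2, Pi.add_apply, Pi.smul_apply, vel_lin]; ring)
  unfold convS
  rw [h1, h2, h3, h4]
  simp only [sym2, Pi.add_apply, Pi.smul_apply, vel_lin, temp_lin, svec_lin,
    Finset.sum_add_distrib, Finset.mul_sum, add_div, mul_add]
  simp only [Fin.sum_univ_three]
  ring

theorem convection_lin (w : State) (c : ℝ) (D E : Fin 3 → State) :
    convection w (c • D + E) = c • convection w D + convection w E := by
  simp only [convection, convDens_lin, convVel_lin, convTemp_lin, convS_lin]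
  funext a
  fin_cases a <;> rfl

/-- The quasi-linear form of the system: the convection terms are `∑ k, A k *ᵥ ∂w/∂x_k` with
the coefficient matrices `A k` above. -/
theorem convection_eq_sum_coeffMatrix (w : State) (D : Fin 3 → State) :
    convection w D = ∑ k, coeffMatrix w k *ᵥ D k := by
  let L : (Fin 3 → State) →ₗ[ℝ] State :=
    { toFun := convection w
      map_add' := fun D E => by
        have h := convection_lin w 1 D E
        rwa [one_smul, one_smul] at h
      map_smul' := fun c D => by
        have h0 := convection_lin w 1 0 0
        rw [smul_zero, add_zero, one_smul, left_eq_add] at h0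
        have h := convection_lin w c D 0
        rwa [h0, add_zero, add_zero] at h }
  have hD : D = ∑ k, ∑ b, D k b • (Pi.single k (Pi.single b 1) : Fin 3 → State) := by
    funext k b
    simp [Finset.sum_apply, Pi.single_apply, Finset.sum_ite_eq, ite_apply]
  have h : L D = ∑ k, ∑ b, D k b • L (Pi.single k (Pi.single b 1)) := by
    conv_lhs => rw [hD]
    simp only [map_sum, map_smul]
  change L D = _
  rw [h]
  funext a
  simp only [Finset.sum_apply, Pi.smul_apply, smul_eq_mul, Matrix.mulVec, dotProduct]
  refine Finset.sum_congr rfl fun k _ => Finset.sum_congr rfl fun b _ => ?_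
  rw [mul_comm]
  rfl

end ThirteenMoment

end

noncomputable section

namespace ThirteenMoment

/-! Diagonalizability is proved by exhibiting enough eigenvectors of the principal symbol in a
direction `n`. Write `Θ = R Rᵀ`. In the coordinates given by `T = R O`, with `O` orthogonal, and
after division by `ρ`, the state becomes `ρ = 1`, `u = 0`, `Θ = 1`. Choosing `O` suitably turns `n`
into a multiple of `e₁` and `s` into `(s, t, 0)` with `s ≥ 0`. By covariance (`symbol_transform`)
the symbol turns into `u·n + c` times the symbol of this normal state, so only a two-parameter
family remains, and `s² + t²` is the invariant `ρ⁻² sᵀ Θ⁻¹ s`.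

Reflection of the third axis fixes the normal state and `e₁`, so the symbol splits into an even
block of size 9 and an odd block of size 4. In each block elimination turns a zero of an explicit
polynomial into an eigenvector, and zeros are located by sign changes. For `s = 0` the zero at the
origin is multiple (triple in the even block, double in the odd one), and a kernel of that dimension
is written down. For `s > 0` all zeros are distinct.

The delicate point is the even block for small `s > 0`. For `t = 0` and `x = s y`, the lowest-order
part of `evenPoly` is `-21/5 s³ (y - 2/5)² (y + 2/5)`: two zeros merge to this order, and only
higher terms separate them (`evenPoly_close_point`). -/

/-! ### Spanning sets of eigenvectors -/

/-- The eigenvectors of `f` span the whole space. -/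
def EigenvectorsSpan {V : Type*} [AddCommGroup V] [Module ℝ V] (f : V →ₗ[ℝ] V) : Prop :=
  Submodule.span ℝ {v : V | ∃ μ : ℝ, f v = μ • v} = ⊤

/-- A spanning set of eigenvectors contains a basis. -/
theorem EigenvectorsSpan.exists_basis {n V : Type*} [AddCommGroup V] [Module ℝ V]
    {f : V →ₗ[ℝ] V} (h : EigenvectorsSpan f) (e : Module.Basis n ℝ V) :
    ∃ b : Module.Basis n ℝ V, ∀ i, ∃ μ : ℝ, f (b i) = μ • b i := by
  have h' : ⊤ ≤ Submodule.span ℝ {v : V | ∃ μ : ℝ, f v = μ • v} := h.ge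
  refine ⟨(Module.Basis.ofSpan h').reindex ((Module.Basis.ofSpan h').indexEquiv e), fun i => ?_⟩
  rw [Module.Basis.reindex_apply]
  exact Module.Basis.ofSpan_subset h' ⟨_, rfl⟩

/-- A matrix whose eigenvectors span the whole space is diagonalizable. -/
theorem realDiagonalizable_of_eigenvectorsSpan {n : Type} [Fintype n] [DecidableEq n]
    (A : Matrix n n ℝ) (h : EigenvectorsSpan (Matrix.toLin' A)) : RealDiagonalizable A := by
  obtain ⟨b, hb⟩ := h.exists_basis (Pi.basisFun ℝ n)
  choose d hd using hb
  let P : Matrix n n ℝ := (Pi.basisFun ℝ n).toMatrix b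
  have hP : IsUnit P.det := by
    have : IsUnit P := by
      let := (Pi.basisFun ℝ n).invertibleToMatrix b
      exact isUnit_of_invertible P
    exact (Matrix.isUnit_iff_isUnit_det P).1 this
  refine ⟨P, d, hP, ?_⟩
  have hAP : A * P = P * Matrix.diagonal d := by
    ext i j
    have := congrFun (hd j) i
    rw [Matrix.toLin'_apply] at this
    rw [Matrix.mul_diagonal]
    simp only [Matrix.mul_apply, P, Module.Basis.toMatrix_apply, Pi.basisFun_repr]
    simpa [Matrix.mulVec, dotProduct, mul_comm] using this
  rw [← hAP, Matrix.mul_assoc, Matrix.mul_nonsing_inv P hP, Matrix.mul_one]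

/-- An endomorphism of an `m`-dimensional space with `m` distinct eigenvalues has a spanning
set of eigenvectors. -/
theorem eigenvectorsSpan_of_distinct {m : ℕ} (f : (Fin m → ℝ) →ₗ[ℝ] Fin m → ℝ) (μ : Fin m → ℝ)
    (hμ : Function.Injective μ) (h : ∀ i, ∃ v, v ≠ 0 ∧ f v = μ i • v) : EigenvectorsSpan f := by
  choose v hv0 hv using h
  have hli := Module.End.eigenvectors_linearIndependent' f μ hμ v fun i =>
    ⟨Module.End.mem_eigenspace_iff.2 (hv i), hv0 i⟩
  rw [EigenvectorsSpan, eq_top_iff, ← hli.span_eq_top_of_card_eq_finrank' (by simp)]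
  exact Submodule.span_mono (Set.range_subset_iff.2 fun i => ⟨μ i, hv i⟩)

/-- An endomorphism of an `m`-dimensional space with `k` linearly independent vectors in its
kernel and `m - k` distinct nonzero eigenvalues has a spanning set of eigenvectors. -/
theorem eigenvectorsSpan_of_kernel {m k l : ℕ} (hm : k + l = m)
    (f : (Fin m → ℝ) →ₗ[ℝ] Fin m → ℝ) (v : Fin k → Fin m → ℝ) (hv : LinearIndependent ℝ v)
    (hfv : ∀ i, f (v i) = 0) (μ : Fin l → ℝ) (hμ : Function.Injective μ) (hμ0 : ∀ i, μ i ≠ 0)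
    (h : ∀ i, ∃ x, x ≠ 0 ∧ f x = μ i • x) : EigenvectorsSpan f := by
  choose x hx0 hx using h
  have hli := Module.End.eigenvectors_linearIndependent' f μ hμ x fun i =>
    ⟨Module.End.mem_eigenspace_iff.2 (hx i), hx0 i⟩
  -- The two spans lie in the eigenspace of `0` and in the supremum of the eigenspaces of nonzero
  -- values, which are independent.
  have hdis : Disjoint (Submodule.span ℝ (Set.range v)) (Submodule.span ℝ (Set.range x)) := by
    refine ((Module.End.eigenspaces_iSupIndep f) 0).mono ?_ ?_
    · rw [Submodule.span_le, Set.range_subset_iff]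
      intro i
      exact Module.End.mem_eigenspace_iff.2 (by rw [hfv, zero_smul])
    · rw [Submodule.span_le, Set.range_subset_iff]
      intro i
      exact (le_iSup₂_of_le (f := fun (j : ℝ) (_ : j ≠ 0) => Module.End.eigenspace f j)
        (μ i) (hμ0 i) le_rfl) (Module.End.mem_eigenspace_iff.2 (hx i))
  have hsum := hv.sum_type hli hdis
  rw [EigenvectorsSpan, eq_top_iff,
    ← hsum.span_eq_top_of_card_eq_finrank' (by simp [hm])]
  refine Submodule.span_mono (Set.range_subset_iff.2 ?_)
  rintro (i | i)
  · exact ⟨0, by simp [hfv]⟩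
  · exact ⟨μ i, hx i⟩

/-- Eigenvectors are carried along by a linear map that intertwines `f` with `c • f + r`. -/
theorem range_le_span_eigenvectors {V W : Type*} [AddCommGroup V] [Module ℝ V] [AddCommGroup W]
    [Module ℝ W] (f : V →ₗ[ℝ] V) (g : W →ₗ[ℝ] W) (S : V →ₗ[ℝ] W) (r c : ℝ)
    (h : ∀ x, g (S x) = S (r • x + c • f x)) (hf : EigenvectorsSpan f) :
    LinearMap.range S ≤ Submodule.span ℝ {v : W | ∃ μ : ℝ, g v = μ • v} := by
  rw [← Submodule.map_top, ← hf, Submodule.map_span, Submodule.span_le]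
  rintro _ ⟨x, ⟨μ, hx⟩, rfl⟩
  refine Submodule.subset_span ⟨r + c * μ, ?_⟩
  rw [h, hx, smul_smul, ← add_smul, map_smul]

/-! ### Sign changes and the two blocks of the normal form -/

/-- A continuous function that changes sign between consecutive points of an increasing
sequence has a zero in each of the intervals. -/
theorem exists_zeros_of_sign_changes {m : ℕ} {p : ℝ → ℝ} (hp : Continuous p)
    (x : Fin (m + 1) → ℝ) (hx : ∀ i : Fin m, x i.castSucc < x i.succ)
    (hs : ∀ i : Fin m, p (x i.castSucc) * p (x i.succ) < 0) :
    ∃ r : Fin m → ℝ, StrictMono r ∧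
      ∀ i, x i.castSucc < r i ∧ r i < x i.succ ∧ p (r i) = 0 := by
  have key : ∀ i : Fin m, ∃ r, x i.castSucc < r ∧ r < x i.succ ∧ p r = 0 := by
    intro i
    rcases mul_neg_iff.1 (hs i) with ⟨h1, h2⟩ | ⟨h1, h2⟩
    · obtain ⟨r, hr, h0⟩ := intermediate_value_Ioo' (hx i).le hp.continuousOn ⟨h2, h1⟩
      exact ⟨r, hr.1, hr.2, h0⟩
    · obtain ⟨r, hr, h0⟩ := intermediate_value_Ioo (hx i).le hp.continuousOn ⟨h1, h2⟩
      exact ⟨r, hr.1, hr.2, h0⟩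
  choose r hr using key
  refine ⟨r, fun i j hij => ?_, hr⟩
  have hmono : Monotone x := Fin.monotone_iff_le_succ.2 fun i => (hx i).le
  have : x i.succ ≤ x j.castSucc := hmono (by simpa [Fin.le_def] using hij)
  exact (hr i).2.1.trans_le (this.trans (hr j).1.le)

/-- The principal symbol, in an adapted orthonormal frame, on the perturbations
`(ρ, u₁, u₂, θ₁₁, θ₂₂, θ₃₃, θ₁₂, s₁, s₂)` that are even under reflection of the third axis,
for the state with `ρ = 1`, `u = 0`, `Θ = 1` and `s = (s, t, 0)`. -/
def evenSymbol (s t : ℝ) : (Fin 9 → ℝ) →ₗ[ℝ] Fin 9 → ℝ where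
  toFun x :=
    ![x 1,
      x 0 + x 3,
      x 6,
      2 * x 1 + 6 / 5 * s * x 3 + 6 / 5 * x 7,
      2 / 5 * s * x 4 + 4 / 5 * t * x 6 + 2 / 5 * x 7,
      2 / 5 * s * x 5 + 2 / 5 * x 7,
      x 2 + 2 / 5 * t * x 3 + 4 / 5 * s * x 6 + 2 / 5 * x 8,
      2 * s * x 1 + (3 / 2 - 18 / 25 * s ^ 2 - 4 / 25 * t ^ 2) * x 3 +
        (1 / 2 - 2 / 25 * s ^ 2) * (x 4 + x 5) - 12 / 25 * s * t * x 6 -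
        22 / 25 * s * x 7 - 4 / 25 * t * x 8,
      t * x 1 + s * x 2 - 2 / 5 * s * t * x 3 - 6 / 25 * s * t * x 4 - 2 / 25 * s * t * x 5 +
        (1 - 8 / 25 * s ^ 2 - 12 / 25 * t ^ 2) * x 6 - 14 / 25 * t * x 7 - 4 / 25 * s * x 8]
  map_add' x y := by
    ext i
    fin_cases i <;> simp <;> ring
  map_smul' c x := by
    ext i
    fin_cases i <;> simp <;> ring

/-- The characteristic polynomial of `evenSymbol s t`. -/
def evenPoly (s t x : ℝ) : ℝ :=
  x ^ 9 - 44 / 25 * s * x ^ 8 +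
    (-33 / 5 + 184 / 625 * t ^ 2 + 628 / 625 * s ^ 2) * x ^ 7 +
    (622 / 125 * s - 432 / 3125 * s * t ^ 2 - 576 / 3125 * s ^ 3) * x ^ 6 +
    (257 / 25 - 584 / 625 * t ^ 2 + 1204 / 625 * s ^ 2) * x ^ 5 +
    (-288 / 125 * s - 1072 / 3125 * s * t ^ 2 - 6648 / 3125 * s ^ 3) * x ^ 4 +
    (-21 / 5 + 24 / 625 * t ^ 2 - 812 / 625 * s ^ 2 + 4608 / 15625 * s ^ 2 * t ^ 2 +
      6144 / 15625 * s ^ 4) * x ^ 3 +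
    (42 / 25 * s + 288 / 3125 * s * t ^ 2 - 1968 / 3125 * s ^ 3) * x ^ 2 +
    (84 / 125 * s ^ 2 - 672 / 15625 * s ^ 2 * t ^ 2 + 5376 / 15625 * s ^ 4) * x -
    168 / 625 * s ^ 3

/-- The principal symbol, in an adapted orthonormal frame, on the perturbations
`(u₃, θ₁₃, θ₂₃, s₃)` that are odd under reflection of the third axis, for the state with
`ρ = 1`, `u = 0`, `Θ = 1` and `s = (s, t, 0)`. -/
def oddSymbol (s t : ℝ) : (Fin 4 → ℝ) →ₗ[ℝ] Fin 4 → ℝ where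
  toFun x :=
    ![x 1,
      x 0 + 4 / 5 * s * x 1 + 2 / 5 * x 3,
      2 / 5 * t * x 1 + 2 / 5 * s * x 2,
      s * x 0 + (1 - 8 / 25 * s ^ 2 - 4 / 25 * t ^ 2) * x 1 - 4 / 25 * s * t * x 2 -
        4 / 25 * s * x 3]
  map_add' x y := by
    ext i
    fin_cases i <;> simp <;> ring
  map_smul' c x := by
    ext i
    fin_cases i <;> simp <;> ring

/-- The characteristic polynomial of `oddSymbol s t`. -/
def oddPoly (s t x : ℝ) : ℝ :=
  x ^ 4 - 26 / 25 * s * x ^ 3 + (32 / 125 * s ^ 2 + 8 / 125 * t ^ 2 - 7 / 5) * x ^ 2 +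
    28 / 125 * s ^ 2

/-! ### Eigenvectors from zeros of the polynomials -/

/-- A singular system of two linear equations in two unknowns has a nonzero solution. -/
theorem exists_ne_zero_of_det_eq_zero {a b c d : ℝ} (h : a * d - b * c = 0) :
    ∃ p q : ℝ, (p ≠ 0 ∨ q ≠ 0) ∧ a * p + b * q = 0 ∧ c * p + d * q = 0 := by
  by_cases h1 : a = 0 ∧ b = 0
  · by_cases h2 : c = 0 ∧ d = 0
    · exact ⟨1, 0, by simp [h1, h2]⟩
    · refine ⟨-d, c, ?_, by simp [h1], by ring⟩
      by_contra! h3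
      exact h2 ⟨h3.2, neg_eq_zero.1 h3.1⟩
  · refine ⟨-b, a, ?_, by ring, by linear_combination h⟩
    by_contra! h3
    exact h1 ⟨h3.2, neg_eq_zero.1 h3.1⟩

theorem evenSymbol_eq_smul {s t x a b c d e f g h k : ℝ} (h0 : b = x * a) (h1 : a + d = x * b)
    (h2 : g = x * c) (h3 : 2 * b + 6 / 5 * s * d + 6 / 5 * h = x * d)
    (h4 : 2 / 5 * s * e + 4 / 5 * t * g + 2 / 5 * h = x * e)
    (h5 : 2 / 5 * s * f + 2 / 5 * h = x * f)
    (h6 : c + 2 / 5 * t * d + 4 / 5 * s * g + 2 / 5 * k = x * g)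
    (h7 : 2 * s * b + (3 / 2 - 18 / 25 * s ^ 2 - 4 / 25 * t ^ 2) * d +
      (1 / 2 - 2 / 25 * s ^ 2) * (e + f) - 12 / 25 * s * t * g - 22 / 25 * s * h -
      4 / 25 * t * k = x * h)
    (h8 : t * b + s * c - 2 / 5 * s * t * d - 6 / 25 * s * t * e - 2 / 25 * s * t * f +
      (1 - 8 / 25 * s ^ 2 - 12 / 25 * t ^ 2) * g - 14 / 25 * t * h - 4 / 25 * s * k = x * k) :
    evenSymbol s t ![a, b, c, d, e, f, g, h, k] = x • ![a, b, c, d, e, f, g, h, k] := by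
  ext i
  fin_cases i
  exacts [h0, h1, h2, h3, h4, h5, h6, h7, h8]

/-- All rows but the last two can be solved in terms of the density and `u₂`. The rows of `θ₂₂` and
`θ₃₃` require division by `x - 2/5 s`, hence the exceptional value. At that value with `t = 0`, the
perturbation `θ₂₂ - θ₃₃` is an eigenvector. -/
theorem evenSymbol_eigenvector {s t x : ℝ} (hx : evenPoly s t x = 0)
    (h : x ≠ 2 / 5 * s ∨ t = 0) : ∃ v, v ≠ 0 ∧ evenSymbol s t v = x • v := by
  by_cases hxs : x = 2 / 5 * s
  · have ht : t = 0 := h.resolve_left (not_not.2 hxs)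
    refine ⟨![0, 0, 0, 0, 1, -1, 0, 0, 0], fun h0 => ?_, ?_⟩
    · simpa using congrFun h0 4
    · subst hxs ht
      ext i
      fin_cases i <;> simp [evenSymbol]
  -- The two rows left after elimination, as a system in `p` and `q`; its determinant is `25/12`
  -- times `evenPoly s t x`.
  · obtain ⟨p, q, hpq, h1, h2⟩ := exists_ne_zero_of_det_eq_zero
      (a := -32 / 25 * s ^ 2 * x + 3 / 5 * s * x ^ 4 + 6 / 5 * s * x ^ 2 + s - 5 / 6 * x ^ 5 +
        13 / 3 * x ^ 3 - 5 / 2 * x)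
      (b := -4 / 25 * s * t - 2 / 5 * t * x ^ 3 + 4 / 5 * t * x)
      (c := -14 / 25 * s * t * x + 8 / 15 * t * x ^ 4 + 7 / 5 * t * x ^ 2)
      (d := -16 / 25 * s ^ 2 * x ^ 2 - 14 / 25 * s ^ 2 + 13 / 5 * s * x ^ 3 -
        12 / 25 * t ^ 2 * x ^ 2 - 5 / 2 * x ^ 4 + 7 / 2 * x ^ 2)
      (by rw [evenPoly] at hx; linear_combination 25 / 12 * hx)
    have hh : x - 2 / 5 * s ≠ 0 := sub_ne_zero.2 hxs
    -- The row of `θ₁₁` determines the `s₁` component as `z (x - 2/5 s)`. Density and `u₂` carry the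
    -- same factor, so that `θ₂₂` and `θ₃₃` need no division.
    obtain ⟨z, hz⟩ : ∃ z, z = 5 / 6 * ((x - 6 / 5 * s) * (x ^ 2 - 1) - 2 * x) * p := ⟨_, rfl⟩
    refine ⟨![(x - 2 / 5 * s) * p, x * (x - 2 / 5 * s) * p, (x - 2 / 5 * s) * q,
      (x ^ 2 - 1) * (x - 2 / 5 * s) * p, 4 / 5 * t * x * q + 2 / 5 * z, 2 / 5 * z,
      x * (x - 2 / 5 * s) * q, z * (x - 2 / 5 * s),
      5 / 2 * ((x - 4 / 5 * s) * x - 1) * (x - 2 / 5 * s) * q -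
        t * (x ^ 2 - 1) * (x - 2 / 5 * s) * p], fun h0 => ?_, ?_⟩
    · have e0 : (x - 2 / 5 * s) * p = 0 := congrFun h0 0
      have e2 : (x - 2 / 5 * s) * q = 0 := congrFun h0 2
      exact hpq.elim (fun h => h ((mul_eq_zero.1 e0).resolve_left hh))
        fun h => h ((mul_eq_zero.1 e2).resolve_left hh)
    · apply evenSymbol_eq_smul
      · ring
      · ring
      · ring
      · rw [hz]; ring
      · ring
      · ring
      · ring
      · rw [hz]; linear_combination h1
      · rw [hz]; linear_combination h2

/-- Here only the row of `θ₂₃` requires division by `x - 2/5 s`; the last row then reduces to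
`oddPoly s t x = 0`. In the exceptional case `θ₂₃` alone is an eigenvector. -/
theorem oddSymbol_eigenvector {s t x : ℝ} (hx : oddPoly s t x = 0)
    (h : x ≠ 2 / 5 * s ∨ t = 0) : ∃ v, v ≠ 0 ∧ oddSymbol s t v = x • v := by
  by_cases hxs : x = 2 / 5 * s
  · have ht : t = 0 := h.resolve_left (not_not.2 hxs)
    refine ⟨![0, 0, 1, 0], fun h0 => ?_, ?_⟩
    · simpa using congrFun h0 2
    · subst hxs ht
      ext i
      fin_cases i <;> simp [oddSymbol]
  · have hh : x - 2 / 5 * s ≠ 0 := sub_ne_zero.2 hxs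
    refine ⟨![x - 2 / 5 * s, x * (x - 2 / 5 * s), 2 / 5 * t * x,
      5 / 2 * ((x - 4 / 5 * s) * x - 1) * (x - 2 / 5 * s)], fun h0 => ?_, ?_⟩
    · exact hh (by simpa using congrFun h0 0)
    · rw [oddPoly] at hx
      ext i
      fin_cases i
      · simp [oddSymbol]
      · simp [oddSymbol]; ring
      · simp [oddSymbol]; ring
      · simp [oddSymbol]; linear_combination (-5 / 2) * hx

/-! ### Location of the zeros -/

/-- `evenPoly s t` is positive at a point between its two close zeros. -/
theorem evenPoly_close_point (s t : ℝ) (hs : 0 < s) (hs1 : s ≤ 1 / 100) :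
    0 < evenPoly s t (2 / 5 * s - 1 / 100 * s ^ 3) := by
  -- With `z = s²`, the value at the test point is `s⁷` times the first expression plus `s⁵ t²`
  -- times the second. The point lies to the left of `2/5 s` because `2/5 s` is itself a zero when
  -- `t = 0`.
  have key : ∀ z : ℝ, 0 < z → z ≤ 1 / 100 →
      0 < 371 / 1562500 + 93729 / 625000000 * z + 3097 / 3906250000 * z ^ 2 -
        15987 / 156250000000 * z ^ 3 - 14213 / 1250000000000 * z ^ 4 +
        217 / 781250000000 * z ^ 5 + 21 / 15625000000000 * z ^ 6 +
        2329 / 12500000000000000 * z ^ 7 - 177 / 15625000000000000 * z ^ 8 +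
        23 / 125000000000000000 * z ^ 9 - 1 / 1000000000000000000 * z ^ 10 ∧
      0 ≤ 64 / 1953125 + 28739 / 48828125 * z - 111051 / 1953125000 * z ^ 2 +
        3383 / 1220703125 * z ^ 3 - 133 / 1220703125 * z ^ 4 + 2633 / 781250000000 * z ^ 5 -
        321 / 4882812500000 * z ^ 6 + 67 / 97656250000000 * z ^ 7 -
        23 / 7812500000000000 * z ^ 8 := by
    intro z hz hz1
    have h0 : ∀ k : ℕ, 0 ≤ z ^ k := fun k => pow_nonneg hz.le k
    have h1 : ∀ k : ℕ, z ^ (k + 1) ≤ 1 / 100 := fun k => by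
      calc z ^ (k + 1) ≤ z ^ 1 := pow_le_pow_of_le_one hz.le (by linarith) (by omega)
        _ ≤ 1 / 100 := by simpa using hz1
    constructor
    · linarith [h0 2, h1 2, h1 3, h0 5, h0 6, h0 7, h1 7, h0 9, h1 9]
    · linarith [h1 1, h0 3, h1 3, h0 5, h1 5, h0 7, h1 7]
  obtain ⟨h1, h2⟩ := key (s ^ 2) (by positivity) (by nlinarith)
  have h3 := mul_pos (pow_pos hs 7) h1
  have h4 := mul_nonneg (mul_nonneg (pow_pos hs 5).le (sq_nonneg t)) h2
  refine (add_pos_of_pos_of_nonneg h3 h4).trans_eq ?_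
  rw [evenPoly]
  ring

/-- Excludes the value at which the elimination fails, whenever `t ≠ 0`. -/
theorem evenPoly_two_fifths_ne_zero {s t : ℝ} (hs : 0 < s) (hs1 : s ≤ 1 / 100) (ht : t ≠ 0) :
    evenPoly s t (2 / 5 * s) ≠ 0 := by
  have h : evenPoly s t (2 / 5 * s) =
      1024 / 1953125 * s ^ 5 * t ^ 2 * (1 - 4 / 25 * s ^ 2) := by
    rw [evenPoly]
    ring
  have h1 : 0 < 1 - 4 / 25 * s ^ 2 := by nlinarith
  rw [h]
  positivity

theorem oddPoly_two_fifths_ne_zero {s t : ℝ} (hs : 0 < s) (ht : t ≠ 0) :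
    oddPoly s t (2 / 5 * s) ≠ 0 := by
  have h : oddPoly s t (2 / 5 * s) = 32 / 3125 * s ^ 2 * t ^ 2 := by
    rw [oddPoly]
    ring
  rw [h]
  positivity

/-- The signs of `evenPoly s t` away from its three zeros near `0`. -/
theorem evenPoly_signs {s t : ℝ} (hs : 0 ≤ s) (hs1 : s ≤ 1 / 100) (ht : t ^ 2 ≤ 1 / 100) :
    evenPoly s t (-3) < 0 ∧ 0 < evenPoly s t (-3 / 2) ∧ evenPoly s t (-1) < 0 ∧
      0 < evenPoly s t (-1 / 2) ∧ evenPoly s t (1 / 2) < 0 ∧ 0 < evenPoly s t 1 ∧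
      evenPoly s t (3 / 2) < 0 ∧ 0 < evenPoly s t 3 := by
  have ht0 := sq_nonneg t
  -- With each monomial in `s` and `t²` bounded separately, the eight sign claims become linear in
  -- the monomials.
  have b1 : ∀ k : ℕ, 0 ≤ s ^ (k + 1) ∧ s ^ (k + 1) ≤ 1 / 100 := fun k =>
    ⟨pow_nonneg hs _,
      calc s ^ (k + 1) ≤ s ^ 1 := pow_le_pow_of_le_one hs (by linarith) (by omega)
        _ ≤ 1 / 100 := by simpa using hs1⟩
  have b2 : ∀ k : ℕ, 0 ≤ s ^ (k + 1) * t ^ 2 ∧ s ^ (k + 1) * t ^ 2 ≤ 1 / 100 := fun k => by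
    obtain ⟨h1, h2⟩ := b1 k
    constructor
    · positivity
    · nlinarith
  obtain ⟨c2, d2⟩ := b1 1
  obtain ⟨c3, d3⟩ := b1 2
  obtain ⟨c4, d4⟩ := b1 3
  obtain ⟨e1, f1⟩ := b2 0
  obtain ⟨e2, f2⟩ := b2 1
  norm_num at c2 d2 c3 d3 c4 d4 e1 f1 e2 f2
  simp only [evenPoly]
  refine ⟨?_, ?_, ?_, ?_, ?_, ?_, ?_, ?_⟩ <;> ring_nf <;> linarith

theorem evenSymbol_eigenvectorsSpan {s t : ℝ} (hs : 0 ≤ s) (hs1 : s ≤ 1 / 100)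
    (ht : t ^ 2 ≤ 1 / 100) : EigenvectorsSpan (evenSymbol s t) := by
  have hcont : Continuous (evenPoly s t) := by
    unfold evenPoly
    fun_prop
  obtain ⟨g0, g1, g2, g3, g4, g5, g6, g7⟩ := evenPoly_signs hs hs1 ht
  rcases hs.eq_or_lt with rfl | hs0
  · obtain ⟨r, hr, hr0⟩ := exists_zeros_of_sign_changes hcont
      ![-3, -3 / 2, -1, -1 / 2, 1 / 2, 1, 3 / 2, 3]
      (by
        intro i
        fin_cases i
        exacts [(by norm_num : (-3 : ℝ) < -3 / 2), (by norm_num : (-3 / 2 : ℝ) < -1),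
          (by norm_num : (-1 : ℝ) < -1 / 2), (by norm_num : (-1 / 2 : ℝ) < 1 / 2),
          (by norm_num : (1 / 2 : ℝ) < 1), (by norm_num : (1 : ℝ) < 3 / 2),
          (by norm_num : (3 / 2 : ℝ) < 3)])
      (by
        intro i
        fin_cases i
        exacts [mul_neg_of_neg_of_pos g0 g1, mul_neg_of_pos_of_neg g1 g2,
          mul_neg_of_neg_of_pos g2 g3, mul_neg_of_pos_of_neg g3 g4, mul_neg_of_neg_of_pos g4 g5,
          mul_neg_of_pos_of_neg g5 g6, mul_neg_of_neg_of_pos g6 g7])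
    -- The omitted `r 3` is the zero found in `(-1/2, 1/2)`; the kernel takes its place.
    have hne : ∀ i : Fin 6, r (![0, 1, 2, 4, 5, 6] i) ≠ 0 := by
      have a2 : r 2 < -1 / 2 := (hr0 2).2.1
      have a4 : 1 / 2 < r 4 := (hr0 4).1
      have a0 : r 0 < r 2 := hr (by decide)
      have a1 : r 1 < r 2 := hr (by decide)
      have a5 : r 4 < r 5 := hr (by decide)
      have a6 : r 4 < r 6 := hr (by decide)
      intro i
      fin_cases i
      exacts [(by linarith : r 0 < 0).ne, (by linarith : r 1 < 0).ne, (by linarith : r 2 < 0).ne,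
        (by linarith : 0 < r 4).ne', (by linarith : 0 < r 5).ne', (by linarith : 0 < r 6).ne']
    refine eigenvectorsSpan_of_kernel (k := 3) (l := 6) (by norm_num) _
      -- Kernel of the symbol at `s = 0`. Coordinates 5, 8 and 0 are each nonzero in exactly one of
      -- the three vectors, which gives independence.
      ![![0, 0, 0, 0, 1, -1, 0, 0, 0],
        ![0, 0, -2 / 5, 0, 8 / 25 * t, 0, 0, 0, 1],
        ![1, 0, 2 / 5 * t, -1, 3 - 8 / 25 * t ^ 2, 0, 0, 0, 0]] ?_ ?_
      (fun i => r (![0, 1, 2, 4, 5, 6] i)) (hr.injective.comp (by decide)) hne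
      fun i => evenSymbol_eigenvector (hr0 _).2.2 (Or.inl (by simpa using hne i))
    · rw [Fintype.linearIndependent_iff]
      intro g hg
      have k0 := congrFun hg 5
      have k1 := congrFun hg 8
      have k2 := congrFun hg 0
      simp [Fin.sum_univ_three] at k0 k1 k2
      intro i
      fin_cases i
      exacts [k0, k1, k2]
    · intro i
      fin_cases i
      · simpa using evenSymbol_eq_smul (s := 0) (t := t) (x := 0) (a := 0) (b := 0) (c := 0)
          (d := 0) (e := 1) (f := -1) (g := 0) (h := 0) (k := 0) (by ring) (by ring) (by ring)
          (by ring) (by ring) (by ring) (by ring) (by ring) (by ring)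
      · simpa using evenSymbol_eq_smul (s := 0) (t := t) (x := 0) (a := 0) (b := 0)
          (c := -2 / 5) (d := 0) (e := 8 / 25 * t) (f := 0) (g := 0) (h := 0) (k := 1)
          (by ring) (by ring) (by ring) (by ring) (by ring) (by ring) (by ring) (by ring)
          (by ring)
      · simpa using evenSymbol_eq_smul (s := 0) (t := t) (x := 0) (a := 1) (b := 0)
          (c := 2 / 5 * t) (d := -1) (e := 3 - 8 / 25 * t ^ 2) (f := 0) (g := 0) (h := 0)
          (k := 0) (by ring) (by ring) (by ring) (by ring) (by ring) (by ring) (by ring)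
          (by ring) (by ring)
  · have hs3 : 0 < s ^ 3 := pow_pos hs0 3
    have hs31 : s ^ 3 ≤ s := by
      simpa using pow_le_pow_of_le_one hs (by linarith) (show 1 ≤ 3 by norm_num)
    have c4 : evenPoly s t 0 < 0 := by
      simp only [evenPoly]
      ring_nf
      linarith
    have c5 := evenPoly_close_point s t hs0 hs1
    -- The points `0` and `2/5 s - s³/100` cut `(-1/2, 1/2)` into three intervals, one for each
    -- small zero, making nine zeros in all.
    obtain ⟨r, hr, hr0⟩ := exists_zeros_of_sign_changes hcont
      ![-3, -3 / 2, -1, -1 / 2, 0, 2 / 5 * s - 1 / 100 * s ^ 3, 1 / 2, 1, 3 / 2, 3]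
      (by
        intro i
        have k1 : 0 < 2 / 5 * s - 1 / 100 * s ^ 3 := by linarith
        have k2 : 2 / 5 * s - 1 / 100 * s ^ 3 < 1 / 2 := by linarith
        fin_cases i
        exacts [(by norm_num : (-3 : ℝ) < -3 / 2), (by norm_num : (-3 / 2 : ℝ) < -1),
          (by norm_num : (-1 : ℝ) < -1 / 2), (by norm_num : (-1 / 2 : ℝ) < 0),
          k1, k2,
          (by norm_num : (1 / 2 : ℝ) < 1), (by norm_num : (1 : ℝ) < 3 / 2),
          (by norm_num : (3 / 2 : ℝ) < 3)])
      (by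
        intro i
        fin_cases i
        exacts [mul_neg_of_neg_of_pos g0 g1, mul_neg_of_pos_of_neg g1 g2,
          mul_neg_of_neg_of_pos g2 g3, mul_neg_of_pos_of_neg g3 c4, mul_neg_of_neg_of_pos c4 c5,
          mul_neg_of_pos_of_neg c5 g4, mul_neg_of_neg_of_pos g4 g5, mul_neg_of_pos_of_neg g5 g6,
          mul_neg_of_neg_of_pos g6 g7])
    refine eigenvectorsSpan_of_distinct _ r hr.injective fun i =>
      evenSymbol_eigenvector (hr0 i).2.2 ?_
    by_contra! h
    exact evenPoly_two_fifths_ne_zero hs0 hs1 h.2 (h.1 ▸ (hr0 i).2.2)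

/-- At `s = 0` the polynomial is `x² (x² - 7/5 + 8/125 t²)`. For `s > 0` its value `28/125 s²` at
`0` is positive and splits the double zero into one of each sign. -/
theorem oddSymbol_eigenvectorsSpan {s t : ℝ} (hs : 0 ≤ s) (hs1 : s ≤ 1 / 100)
    (ht : t ^ 2 ≤ 1 / 100) : EigenvectorsSpan (oddSymbol s t) := by
  rcases hs.eq_or_lt with rfl | hs0
  · have hc : 0 < 7 / 5 - 8 / 125 * t ^ 2 := by linarith
    have hr := Real.sqrt_pos.2 hc
    have hr2 := Real.sq_sqrt hc.le
    set r := √(7 / 5 - 8 / 125 * t ^ 2)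
    have hne : ∀ i, ![-r, r] i ≠ 0 := by
      intro i
      fin_cases i
      exacts [(neg_neg_of_pos hr).ne, hr.ne']
    refine eigenvectorsSpan_of_kernel (k := 2) (l := 2) (by norm_num) _
      ![![0, 0, 1, 0], ![-2 / 5, 0, 0, 1]] ?_ ?_ ![-r, r] ?_ hne fun i =>
        oddSymbol_eigenvector ?_ (Or.inl (by simpa using hne i))
    · rw [Fintype.linearIndependent_iff]
      intro g hg
      have k0 := congrFun hg 2
      have k1 := congrFun hg 3
      simp at k0 k1
      intro i
      fin_cases i
      exacts [k0, k1]
    · intro i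
      fin_cases i <;> ext j <;> fin_cases j <;> (simp [oddSymbol]; try norm_num)
    · intro i j
      fin_cases i <;> fin_cases j <;> simp <;> linarith
    · have h2 : ![-r, r] i ^ 2 = 7 / 5 - 8 / 125 * t ^ 2 := by
        fin_cases i <;> simp [hr2]
      rw [oddPoly]
      linear_combination (![-r, r] i) ^ 2 * h2
  · have b2 : s ^ 2 ≤ 1 / 100 := by nlinarith
    have hcont : Continuous (oddPoly s t) := by
      unfold oddPoly
      fun_prop
    have g0 : 0 < oddPoly s t (-2) := by rw [oddPoly]; nlinarith
    have g1 : oddPoly s t (-1) < 0 := by rw [oddPoly]; nlinarith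
    have g2 : 0 < oddPoly s t 0 := by rw [oddPoly]; nlinarith
    have g3 : oddPoly s t 1 < 0 := by rw [oddPoly]; nlinarith
    have g4 : 0 < oddPoly s t 2 := by rw [oddPoly]; nlinarith
    obtain ⟨r, hr, hr0⟩ := exists_zeros_of_sign_changes hcont ![-2, -1, 0, 1, 2]
      (by
        intro i
        fin_cases i
        exacts [(by norm_num : (-2 : ℝ) < -1), (by norm_num : (-1 : ℝ) < 0),
          (by norm_num : (0 : ℝ) < 1), (by norm_num : (1 : ℝ) < 2)])
      (by
        intro i
        fin_cases i
        exacts [mul_neg_of_pos_of_neg g0 g1, mul_neg_of_neg_of_pos g1 g2,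
          mul_neg_of_pos_of_neg g2 g3, mul_neg_of_neg_of_pos g3 g4])
    refine eigenvectorsSpan_of_distinct _ r hr.injective fun i =>
      oddSymbol_eigenvector (hr0 i).2.2 ?_
    by_contra! h
    exact oddPoly_two_fifths_ne_zero hs0 h.2 (h.1 ▸ (hr0 i).2.2)

/-! ### The principal symbol in tensor form -/

open Matrix

/-- The principal symbol of the system: the convection terms for a perturbation `v` that varies
in the direction `n`. -/
def symbol (w : State) (n : Fin 3 → ℝ) (v : State) : State :=
  convection w fun k => n k • v

theorem dens_smul (c : ℝ) (v : State) : dens (c • v) = c * dens v := rfl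

theorem vel_smul (c : ℝ) (v : State) : vel (c • v) = c • vel v := by
  ext i
  fin_cases i <;> rfl

theorem temp_smul (c : ℝ) (v : State) : temp (c • v) = c • temp v := by
  ext i j
  fin_cases i <;> fin_cases j <;> rfl

theorem svec_smul (c : ℝ) (v : State) : svec (c • v) = c • svec v := by
  ext i
  fin_cases i <;> rfl

theorem dens_add (v w : State) : dens (v + w) = dens v + dens w := rfl

theorem vel_add (v w : State) : vel (v + w) = vel v + vel w := by
  ext i
  fin_cases i <;> rfl

theorem temp_add (v w : State) : temp (v + w) = temp v + temp w := by
  ext i j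
  fin_cases i <;> fin_cases j <;> rfl

theorem svec_add (v w : State) : svec (v + w) = svec v + svec w := by
  ext i
  fin_cases i <;> rfl

theorem temp_symm (v : State) (i j : Fin 3) : temp v i j = temp v j i := by
  fin_cases i <;> fin_cases j <;> rfl

theorem state_ext {v w : State} (h1 : dens v = dens w) (h2 : vel v = vel w)
    (h3 : temp v = temp w) (h4 : svec v = svec w) : v = w := by
  ext i
  fin_cases i
  exacts [h1, congrFun h2 0, congrFun h2 1, congrFun h2 2, congrFun₂ h3 0 0, congrFun₂ h3 1 1,
    congrFun₂ h3 2 2, congrFun₂ h3 0 1, congrFun₂ h3 0 2, congrFun₂ h3 1 2, congrFun h4 0,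
    congrFun h4 1, congrFun h4 2]

/-- The contraction of the symmetric tensor `σ_{(i} Ψ_{jk)} + Θ_{(ij} q_{k)}` with `n_k`. -/
def fluxMatrix (Θ : Matrix (Fin 3) (Fin 3) ℝ) (σ n : Fin 3 → ℝ) (Ψ : Matrix (Fin 3) (Fin 3) ℝ)
    (q : Fin 3 → ℝ) : Matrix (Fin 3) (Fin 3) ℝ :=
  (1 / 3 : ℝ) • (vecMulVec σ (Ψ *ᵥ n) + vecMulVec (Ψ *ᵥ n) σ + (σ ⬝ᵥ n) • Ψ +
    vecMulVec q (Θ *ᵥ n) + vecMulVec (Θ *ᵥ n) q + (q ⬝ᵥ n) • Θ)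

theorem fluxMatrix_symm {Θ Ψ : Matrix (Fin 3) (Fin 3) ℝ} (hΘ : ∀ i j, Θ i j = Θ j i)
    (hΨ : ∀ i j, Ψ i j = Ψ j i) (σ n q : Fin 3 → ℝ) (i j : Fin 3) :
    fluxMatrix Θ σ n Ψ q i j = fluxMatrix Θ σ n Ψ q j i := by
  simp only [fluxMatrix, Matrix.smul_apply, Matrix.add_apply, vecMulVec_apply, smul_eq_mul, hΘ i j,
    hΨ i j]
  ring

/-- Symmetry of the temperature tensors makes the six permutations coincide in pairs, whence the
factor `1/3` in `fluxMatrix`. -/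
theorem sum_flux3_smul (w v : State) (n : Fin 3 → ℝ) (i j : Fin 3) :
    ∑ k, flux3 w (n k • v) i j k = fluxMatrix (temp w) (svec w) n (temp v) (svec v) i j := by
  simp only [fluxMatrix, flux3, sym3, Matrix.smul_apply, Matrix.add_apply, vecMulVec_apply,
    smul_eq_mul, mulVec, dotProduct, temp_smul, svec_smul, Pi.smul_apply, Fin.sum_univ_three]
  rw [temp_symm v i 0, temp_symm v i 1, temp_symm v i 2, temp_symm v j 0, temp_symm v j 1,
    temp_symm v j 2, temp_symm w i 0, temp_symm w i 1, temp_symm w i 2, temp_symm w j 0,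
    temp_symm w j 1, temp_symm w j 2, temp_symm v j i, temp_symm w j i]
  ring

theorem dens_symbol (w v : State) (n : Fin 3 → ℝ) :
    dens (symbol w n v) = (vel w ⬝ᵥ n) * dens v + dens w * (vel v ⬝ᵥ n) := by
  change convDens w _ = _
  simp only [convDens, dens_smul, vel_smul, Pi.smul_apply, smul_eq_mul, dotProduct,
    Fin.sum_univ_three]
  ring

theorem vel_symbol (w v : State) (n : Fin 3 → ℝ) :
    vel (symbol w n v) =
      (vel w ⬝ᵥ n) • vel v + (dens v / dens w) • (temp w *ᵥ n) + temp v *ᵥ n := by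
  have h : vel (symbol w n v) = convVel w fun k => n k • v := by
    ext i
    fin_cases i <;> rfl
  rw [h]
  ext i
  simp only [convVel, dens_smul, vel_smul, temp_smul, Pi.smul_apply, Pi.add_apply,
    Matrix.smul_apply, smul_eq_mul, dotProduct, mulVec, Fin.sum_univ_three]
  ring

theorem convTemp_smul (w v : State) (n : Fin 3 → ℝ) (i j : Fin 3) :
    convTemp w (fun k => n k • v) i j =
      ((vel w ⬝ᵥ n) • temp v + vecMulVec (temp w *ᵥ n) (vel v) +
        vecMulVec (vel v) (temp w *ᵥ n) + (6 / (5 * dens w)) •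
          fluxMatrix (temp w) (svec w) n (temp v) (svec v)) i j := by
  simp only [convTemp, sum_flux3_smul]
  simp only [sym2, vel_smul, temp_smul, Pi.smul_apply, Matrix.smul_apply, Matrix.add_apply,
    vecMulVec_apply, smul_eq_mul, dotProduct, mulVec, Fin.sum_univ_three]
  rw [temp_symm w i 0, temp_symm w i 1, temp_symm w i 2, temp_symm w j 0, temp_symm w j 1,
    temp_symm w j 2]
  ring

theorem temp_symbol (w v : State) (n : Fin 3 → ℝ) :
    temp (symbol w n v) =
      (vel w ⬝ᵥ n) • temp v + vecMulVec (temp w *ᵥ n) (vel v) +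
        vecMulVec (vel v) (temp w *ᵥ n) + (6 / (5 * dens w)) •
          fluxMatrix (temp w) (svec w) n (temp v) (svec v) := by
  have hs : ∀ i j, convTemp w (fun k => n k • v) i j = convTemp w (fun k => n k • v) j i := by
    intro i j
    rw [convTemp_smul, convTemp_smul]
    simp only [Matrix.smul_apply, Matrix.add_apply, vecMulVec_apply, smul_eq_mul,
      fluxMatrix_symm (temp_symm w) (temp_symm v) _ _ _ i j, temp_symm v i j]
    ring
  ext i j
  rw [← convTemp_smul]
  fin_cases i <;> fin_cases j
  exacts [rfl, rfl, rfl, hs 0 1, rfl, rfl, hs 0 2, hs 1 2, rfl]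

theorem sum_mul_sym3_vectors {K : Matrix (Fin 3) (Fin 3) ℝ} (hK : ∀ i j, K i j = K j i)
    (x y z : Fin 3 → ℝ) (j : Fin 3) :
    ∑ i, ∑ k, K i k * sym3 (fun a b c => x a * y b * z c) i j k =
      ((1 / 3 : ℝ) • ((y ⬝ᵥ K *ᵥ z) • x + (x ⬝ᵥ K *ᵥ z) • y + (x ⬝ᵥ K *ᵥ y) • z)) j := by
  simp only [sym3, Pi.smul_apply, Pi.add_apply, smul_eq_mul, dotProduct, mulVec,
    Fin.sum_univ_three]
  rw [hK 1 0, hK 2 0, hK 2 1]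
  ring

theorem sum_mul_sym3_matrix {K G : Matrix (Fin 3) (Fin 3) ℝ} (hK : ∀ i j, K i j = K j i)
    (hG : ∀ i j, G i j = G j i) (x : Fin 3 → ℝ) (j : Fin 3) :
    ∑ i, ∑ k, K i k * sym3 (fun a b c => x a * G b c) i j k =
      ((1 / 3 : ℝ) • ((K * G).trace • x + (2 : ℝ) • G *ᵥ (K *ᵥ x))) j := by
  simp only [sym3, Pi.smul_apply, Pi.add_apply, smul_eq_mul, dotProduct, mulVec, trace,
    diag_apply, mul_apply, Fin.sum_univ_three]
  rw [hK 1 0, hK 2 0, hK 2 1, hG 0 j, hG 1 j, hG 2 j, hG 1 0, hG 2 0, hG 2 1]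
  ring

/-- Written with traces, dot products and matrix actions only, so that under a change of frame `T`
cancels against `T⁻¹` in every contraction with `Θ⁻¹`. -/
theorem svec_symbol (w v : State) (n : Fin 3 → ℝ) (hK : ∀ i j, (temp w)⁻¹ i j = (temp w)⁻¹ j i) :
    svec (symbol w n v) =
      (vel w ⬝ᵥ n) • svec v -
      (6 / 5 : ℝ) • ((1 / 3 : ℝ) •
        ((svec w ⬝ᵥ (temp w)⁻¹ *ᵥ vel v) • (temp w *ᵥ n) +
          ((temp w *ᵥ n) ⬝ᵥ (temp w)⁻¹ *ᵥ vel v) • svec w +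
          ((temp w *ᵥ n) ⬝ᵥ (temp w)⁻¹ *ᵥ svec w) • vel v)) -
      (18 / (25 * dens w)) • ((1 / 3 : ℝ) •
        (((temp w)⁻¹ * fluxMatrix (temp w) (svec w) n (temp v) (svec v)).trace • svec w +
          (2 : ℝ) • fluxMatrix (temp w) (svec w) n (temp v) (svec v) *ᵥ
            ((temp w)⁻¹ *ᵥ svec w))) +
      (1 / 2 : ℝ) • ((dens w * ((temp w)⁻¹ * temp v).trace) • (temp w *ᵥ n) +
        (2 * dens w) • (temp v *ᵥ n)) +
      (2 / 5 : ℝ) • ((7 / 2 : ℝ) • ((vel v ⬝ᵥ n) • svec w + (svec w ⬝ᵥ n) • vel v) +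
        (svec w ⬝ᵥ (temp w)⁻¹ *ᵥ vel v) • (temp w *ᵥ n)) := by
  have h : svec (symbol w n v) = convS w fun k => n k • v := by
    ext i
    fin_cases i <;> rfl
  rw [h]
  ext j
  have h1 : ∑ i, ∑ k, ∑ l, (temp w)⁻¹ i k *
      sym3 (fun a b c => temp w l a * svec w b * vel (n l • v) c) i j k =
      ∑ i, ∑ k, (temp w)⁻¹ i k *
        sym3 (fun a b c => (temp w *ᵥ n) a * svec w b * vel v c) i j k := by
    refine Finset.sum_congr rfl fun i _ => Finset.sum_congr rfl fun k _ => ?_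
    rw [← Finset.mul_sum]
    congr 1
    simp only [sym3, vel_smul, Pi.smul_apply, smul_eq_mul, mulVec, dotProduct,
      Fin.sum_univ_three, temp_symm w i, temp_symm w j, temp_symm w k]
    ring
  have h2 : ∑ i, ∑ k, ∑ l, (temp w)⁻¹ i k *
      sym3 (fun a b c => svec w a * flux3 w (n l • v) b c l) i j k =
      ∑ i, ∑ k, (temp w)⁻¹ i k * sym3 (fun a b c => svec w a *
        fluxMatrix (temp w) (svec w) n (temp v) (svec v) b c) i j k := by
    refine Finset.sum_congr rfl fun i _ => Finset.sum_congr rfl fun k _ => ?_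
    rw [← Finset.mul_sum]
    congr 1
    simp only [sym3, ← sum_flux3_smul, Fin.sum_univ_three]
    ring
  simp only [convS]
  rw [h1, h2, sum_mul_sym3_vectors hK,
    sum_mul_sym3_matrix hK (fluxMatrix_symm (temp_symm w) (temp_symm v) _ _ _)]
  simp only [Pi.smul_apply, Pi.add_apply, Pi.sub_apply, smul_eq_mul]
  generalize fluxMatrix (temp w) (svec w) n (temp v) (svec v) = G
  have h3 : ∑ i, ∑ k, ∑ l, dens w * (temp w)⁻¹ i k * temp w j l * temp (n l • v) i k =
      dens w * ((temp w)⁻¹ * temp v).trace * (temp w *ᵥ n) j := by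
    simp only [temp_smul, Matrix.smul_apply, smul_eq_mul, trace, diag_apply, mul_apply, mulVec,
      dotProduct, Fin.sum_univ_three, temp_symm v 1 0, temp_symm v 2 0, temp_symm v 2 1]
    ring
  have h4 : ∑ i, ∑ k, ∑ l, (temp w)⁻¹ i k * temp w j l *
      sym2 (fun a b => svec w a * vel (n l • v) b) i k =
      (svec w ⬝ᵥ (temp w)⁻¹ *ᵥ vel v) * (temp w *ᵥ n) j := by
    simp only [sym2, vel_smul, Pi.smul_apply, smul_eq_mul, mulVec, dotProduct,
      Fin.sum_univ_three]
    rw [hK 1 0, hK 2 0, hK 2 1]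
    ring
  have h5 : ∑ l, temp (n l • v) j l = (temp v *ᵥ n) j := by
    simp only [temp_smul, Matrix.smul_apply, smul_eq_mul, mulVec, dotProduct, mul_comm]
  have h6 : ∑ l, sym2 (fun a b => svec w a * vel (n l • v) b) j l =
      ((vel v ⬝ᵥ n) * svec w j + (svec w ⬝ᵥ n) * vel v j) / 2 := by
    simp only [sym2, vel_smul, Pi.smul_apply, smul_eq_mul, dotProduct, Fin.sum_univ_three]
    ring
  have h7 : ∑ k, vel w k * svec (n k • v) j = (vel w ⬝ᵥ n) * svec v j := by
    simp only [svec_smul, Pi.smul_apply, smul_eq_mul, dotProduct, Fin.sum_univ_three]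
    ring
  rw [h3, h4, h5, h6, h7]
  ring

/-! ### Covariance under linear changes of coordinates -/

/-- The change of the state under the linear change of coordinates `T`, with the density and
the vector `s` scaled by `ρ`. -/
def transform (ρ : ℝ) (T : Matrix (Fin 3) (Fin 3) ℝ) : State →ₗ[ℝ] State where
  toFun v :=
    ![ρ * dens v, (T *ᵥ vel v) 0, (T *ᵥ vel v) 1, (T *ᵥ vel v) 2,
      (T * temp v * Tᵀ) 0 0, (T * temp v * Tᵀ) 1 1, (T * temp v * Tᵀ) 2 2,
      (T * temp v * Tᵀ) 0 1, (T * temp v * Tᵀ) 0 2, (T * temp v * Tᵀ) 1 2,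
      ρ * (T *ᵥ svec v) 0, ρ * (T *ᵥ svec v) 1, ρ * (T *ᵥ svec v) 2]
  map_add' v w := by
    simp only [dens_add, vel_add, temp_add, svec_add, mulVec_add, Matrix.add_mul,
      Matrix.add_apply, Pi.add_apply, mul_add]
    ext i
    fin_cases i <;> rfl
  map_smul' c v := by
    simp only [dens_smul, vel_smul, temp_smul, svec_smul, mulVec_smul, Matrix.mul_smul,
      Matrix.smul_mul, Matrix.smul_apply, Pi.smul_apply, smul_eq_mul, mul_left_comm ρ c]
    ext i
    fin_cases i <;> rfl

theorem dens_transform (ρ : ℝ) (T : Matrix (Fin 3) (Fin 3) ℝ) (v : State) :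
    dens (transform ρ T v) = ρ * dens v := rfl

theorem vel_transform (ρ : ℝ) (T : Matrix (Fin 3) (Fin 3) ℝ) (v : State) :
    vel (transform ρ T v) = T *ᵥ vel v := by
  ext i
  fin_cases i <;> rfl

theorem svec_transform (ρ : ℝ) (T : Matrix (Fin 3) (Fin 3) ℝ) (v : State) :
    svec (transform ρ T v) = ρ • T *ᵥ svec v := by
  ext i
  fin_cases i <;> rfl

theorem temp_transpose (v : State) : (temp v)ᵀ = temp v := by
  ext i j
  exact temp_symm v j i

theorem temp_transform (ρ : ℝ) (T : Matrix (Fin 3) (Fin 3) ℝ) (v : State) :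
    temp (transform ρ T v) = T * temp v * Tᵀ := by
  have h : ∀ i j, (T * temp v * Tᵀ) j i = (T * temp v * Tᵀ) i j := fun i j => by
    rw [← transpose_apply (T * temp v * Tᵀ) i j, transpose_mul, transpose_mul,
      transpose_transpose, temp_transpose, Matrix.mul_assoc]
  ext i j
  fin_cases i <;> fin_cases j
  exacts [rfl, rfl, rfl, h 1 0, rfl, rfl, h 2 0, h 2 1, rfl]

theorem transform_surjective {ρ : ℝ} (hρ : ρ ≠ 0) {T : Matrix (Fin 3) (Fin 3) ℝ}
    (hT : IsUnit T.det) : Function.Surjective (transform ρ T) := by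
  intro v
  refine ⟨transform ρ⁻¹ T⁻¹ v, state_ext ?_ ?_ ?_ ?_⟩
  · rw [dens_transform, dens_transform, mul_inv_cancel_left₀ hρ]
  · rw [vel_transform, vel_transform, mulVec_mulVec, mul_nonsing_inv _ hT, one_mulVec]
  · have hT' : IsUnit Tᵀ.det := by rwa [det_transpose]
    rw [temp_transform, temp_transform, transpose_nonsing_inv, Matrix.mul_assoc,
      nonsing_inv_mul_cancel_right _ _ hT', mul_nonsing_inv_cancel_left _ _ hT]
  · rw [svec_transform, svec_transform, mulVec_smul, mulVec_mulVec, mul_nonsing_inv _ hT,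
      one_mulVec, smul_smul, mul_inv_cancel₀ hρ, one_smul]

section
variable {T Θ Ψ K : Matrix (Fin 3) (Fin 3) ℝ} {n n₀ : Fin 3 → ℝ} {c ρ : ℝ}

/-- The direction is a covector, so it is pulled back by `Tᵀ`; `c` is the length factor picked up on
the way to `n₀`. -/
theorem mulVec_dotProduct_frame (hn : Tᵀ *ᵥ n = c • n₀) (x : Fin 3 → ℝ) :
    (T *ᵥ x) ⬝ᵥ n = c * (x ⬝ᵥ n₀) := by
  rw [dotProduct_comm, dotProduct_mulVec, ← mulVec_transpose, hn, smul_dotProduct, smul_eq_mul,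
    dotProduct_comm]

theorem conj_mulVec_frame (hn : Tᵀ *ᵥ n = c • n₀) (A : Matrix (Fin 3) (Fin 3) ℝ) :
    (T * A * Tᵀ) *ᵥ n = c • T *ᵥ (A *ᵥ n₀) := by
  rw [← mulVec_mulVec, hn, mulVec_smul, mulVec_mulVec]

theorem vecMulVec_frame (x y : Fin 3 → ℝ) :
    vecMulVec (T *ᵥ x) (T *ᵥ y) = T * vecMulVec x y * Tᵀ := by
  rw [mul_vecMulVec, vecMulVec_mul, vecMul_transpose]

theorem fluxMatrix_frame (hn : Tᵀ *ᵥ n = c • n₀) (σ q : Fin 3 → ℝ) :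
    fluxMatrix (T * Θ * Tᵀ) (ρ • T *ᵥ σ) n (T * Ψ * Tᵀ) (ρ • T *ᵥ q) =
      (ρ * c) • (T * fluxMatrix Θ σ n₀ Ψ q * Tᵀ) := by
  simp only [fluxMatrix, conj_mulVec_frame hn, smul_vecMulVec, vecMulVec_smul, vecMulVec_frame,
    smul_dotProduct, mulVec_dotProduct_frame hn, Matrix.mul_add, Matrix.add_mul,
    Matrix.mul_smul, Matrix.smul_mul, smul_eq_mul]
  module

theorem inv_frame (hT : IsUnit T.det) (K : Matrix (Fin 3) (Fin 3) ℝ) :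
    T⁻¹ᵀ * K * T⁻¹ * T = T⁻¹ᵀ * K := by
  rw [nonsing_inv_mul_cancel_right _ _ hT]

theorem dotProduct_inv_frame (hT : IsUnit T.det) (x y : Fin 3 → ℝ) :
    (T *ᵥ x) ⬝ᵥ ((T⁻¹ᵀ * K * T⁻¹) *ᵥ (T *ᵥ y)) = x ⬝ᵥ (K *ᵥ y) := by
  rw [mulVec_mulVec, inv_frame hT, ← mulVec_mulVec, dotProduct_mulVec, vecMul_transpose,
    mulVec_mulVec, nonsing_inv_mul _ hT, one_mulVec]

theorem trace_inv_frame (hT : IsUnit T.det) (A : Matrix (Fin 3) (Fin 3) ℝ) :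
    (T⁻¹ᵀ * K * T⁻¹ * (T * A * Tᵀ)).trace = (K * A).trace := by
  have hT' : IsUnit Tᵀ.det := by rwa [det_transpose]
  rw [Matrix.mul_assoc T, ← Matrix.mul_assoc, inv_frame hT, ← Matrix.mul_assoc, trace_mul_comm,
    transpose_nonsing_inv, Matrix.mul_assoc, mul_nonsing_inv_cancel_left _ _ hT']

theorem conj_mulVec_inv_frame (hT : IsUnit T.det) (A : Matrix (Fin 3) (Fin 3) ℝ)
    (y : Fin 3 → ℝ) :
    (T * A * Tᵀ) *ᵥ ((T⁻¹ᵀ * K * T⁻¹) *ᵥ (T *ᵥ y)) = T *ᵥ (A *ᵥ (K *ᵥ y)) := by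
  have hT' : IsUnit Tᵀ.det := by rwa [det_transpose]
  rw [mulVec_mulVec _ _ T, inv_frame hT, mulVec_mulVec, transpose_nonsing_inv,
    Matrix.mul_assoc (T * A), mul_nonsing_inv_cancel_left _ _ hT']
  simp only [mulVec_mulVec, Matrix.mul_assoc]

theorem inv_conj_frame (T Θ : Matrix (Fin 3) (Fin 3) ℝ) :
    (T * Θ * Tᵀ)⁻¹ = T⁻¹ᵀ * Θ⁻¹ * T⁻¹ := by
  rw [Matrix.mul_inv_rev, Matrix.mul_inv_rev, transpose_nonsing_inv, Matrix.mul_assoc]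

end

theorem temp_inv_symm (w : State) (i j : Fin 3) : (temp w)⁻¹ i j = (temp w)⁻¹ j i := by
  have h : ((temp w)⁻¹)ᵀ = (temp w)⁻¹ := by rw [transpose_nonsing_inv, temp_transpose]
  exact congrFun₂ h j i

/-- Covariance of the system under linear changes of coordinates and rescaling. -/
theorem symbol_transform {w w₀ : State} {ρ c : ℝ} {T : Matrix (Fin 3) (Fin 3) ℝ}
    {n n₀ : Fin 3 → ℝ} (hρ : ρ ≠ 0) (hT : IsUnit T.det) (hw : dens w = ρ)
    (hw₀ : dens w₀ = 1) (hu₀ : vel w₀ = 0) (hΘ : temp w = T * temp w₀ * Tᵀ)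
    (hs : svec w = ρ • T *ᵥ svec w₀) (hn : Tᵀ *ᵥ n = c • n₀) (v : State) :
    symbol w n (transform ρ T v) =
      transform ρ T ((vel w ⬝ᵥ n) • v + c • symbol w₀ n₀ v) := by
  apply state_ext
  · rw [dens_transform, dens_symbol, dens_add, dens_smul, dens_smul, dens_symbol, dens_transform,
      vel_transform, mulVec_dotProduct_frame hn, hw, hw₀, hu₀, zero_dotProduct]
    ring
  · rw [vel_transform, vel_symbol, vel_add, vel_smul, vel_smul, vel_symbol, dens_transform,
      vel_transform, temp_transform, hΘ, conj_mulVec_frame hn, conj_mulVec_frame hn, hw, hw₀,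
      hu₀, zero_dotProduct, mul_div_cancel_left₀ _ hρ]
    simp only [mulVec_add, mulVec_smul, zero_smul, zero_add, div_one]
    module
  · rw [temp_transform, temp_symbol, temp_add, temp_smul, temp_smul, temp_symbol, vel_transform,
      svec_transform, temp_transform, hΘ, hs, fluxMatrix_frame hn, conj_mulVec_frame hn, hw, hw₀,
      hu₀, zero_dotProduct]
    simp only [smul_vecMulVec, vecMulVec_smul, vecMulVec_frame, Matrix.mul_add, Matrix.add_mul,
      Matrix.mul_smul, Matrix.smul_mul, zero_smul, zero_add, smul_smul]
    have h : 6 / (5 * ρ) * (ρ * c) = c * (6 / (5 * 1)) := by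
      field_simp
    rw [h]
    module
  · rw [svec_transform, svec_symbol _ _ _ (temp_inv_symm w), svec_add, svec_smul, svec_smul,
      svec_symbol _ _ _ (temp_inv_symm w₀), vel_transform, svec_transform, temp_transform, hΘ,
      hs, fluxMatrix_frame hn, conj_mulVec_frame hn, conj_mulVec_frame hn, inv_conj_frame, hw,
      hw₀, hu₀]
    simp only [zero_dotProduct, mulVec_smul, smul_mulVec, dotProduct_smul, smul_dotProduct,
      dotProduct_inv_frame hT, trace_inv_frame hT, conj_mulVec_inv_frame hT, Matrix.mul_smul,
      trace_smul, mulVec_dotProduct_frame hn, mulVec_add, mulVec_sub, smul_eq_mul]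
    ext i
    simp only [Pi.add_apply, Pi.sub_apply, Pi.smul_apply, smul_eq_mul]
    field_simp
    ring

/-! ### The normal state and its reflection symmetry -/

/-- The state with `ρ = 1`, `u = 0`, `Θ = 1` and `s = (s, t, 0)`. -/
def normalState (s t : ℝ) : State := ![1, 0, 0, 0, 1, 1, 1, 0, 0, 0, s, t, 0]

theorem temp_normalState (s t : ℝ) : temp (normalState s t) = 1 := by
  ext i j
  fin_cases i <;> fin_cases j <;> rfl

/-- The perturbations that are even under reflection of the third axis. -/
def evenPart : (Fin 9 → ℝ) →ₗ[ℝ] State where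
  toFun x := ![x 0, x 1, x 2, 0, x 3, x 4, x 5, x 6, 0, 0, x 7, x 8, 0]
  map_add' x y := by
    ext i
    fin_cases i <;> simp
  map_smul' c x := by
    ext i
    fin_cases i <;> simp

/-- The perturbations that are odd under reflection of the third axis. -/
def oddPart : (Fin 4 → ℝ) →ₗ[ℝ] State where
  toFun x := ![0, 0, 0, x 0, 0, 0, 0, 0, x 1, x 2, 0, 0, x 3]
  map_add' x y := by
    ext i
    fin_cases i <;> simp
  map_smul' c x := by
    ext i
    fin_cases i <;> simp

theorem evenPart_add_oddPart (v : State) :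
    evenPart ![v 0, v 1, v 2, v 4, v 5, v 6, v 7, v 10, v 11] +
      oddPart ![v 3, v 8, v 9, v 12] = v := by
  ext i
  fin_cases i <;> simp [evenPart, oddPart]

theorem fluxMatrix_normalState (s t : ℝ) (v : State) :
    fluxMatrix 1 ![s, t, 0] ![1, 0, 0] (temp v) (svec v) =
      !![s * v 4 + v 10, (2 * s * v 7 + t * v 4 + v 11) / 3, (2 * s * v 8 + v 12) / 3;
        (2 * s * v 7 + t * v 4 + v 11) / 3, (s * v 5 + 2 * t * v 7 + v 10) / 3,
          (s * v 9 + t * v 8) / 3;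
        (2 * s * v 8 + v 12) / 3, (s * v 9 + t * v 8) / 3, (s * v 6 + v 10) / 3] := by
  ext i j
  simp only [fluxMatrix, one_mulVec]
  simp only [Matrix.smul_apply, Matrix.add_apply, vecMulVec_apply, mulVec, dotProduct,
    Fin.sum_univ_three, smul_eq_mul]
  fin_cases i <;> fin_cases j <;> simp [temp, svec] <;> ring

theorem symbol_normalState (s t : ℝ) (v : State) :
    symbol (normalState s t) ![1, 0, 0] v =
      ![v 1,
        v 0 + v 4,
        v 7,
        v 8,
        2 * v 1 + 6 / 5 * s * v 4 + 6 / 5 * v 10,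
        2 / 5 * s * v 5 + 4 / 5 * t * v 7 + 2 / 5 * v 10,
        2 / 5 * s * v 6 + 2 / 5 * v 10,
        v 2 + 2 / 5 * t * v 4 + 4 / 5 * s * v 7 + 2 / 5 * v 11,
        v 3 + 4 / 5 * s * v 8 + 2 / 5 * v 12,
        2 / 5 * t * v 8 + 2 / 5 * s * v 9,
        2 * s * v 1 + (3 / 2 - 18 / 25 * s ^ 2 - 4 / 25 * t ^ 2) * v 4 +
          (1 / 2 - 2 / 25 * s ^ 2) * (v 5 + v 6) - 12 / 25 * s * t * v 7 -
          22 / 25 * s * v 10 - 4 / 25 * t * v 11,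
        t * v 1 + s * v 2 - 2 / 5 * s * t * v 4 - 6 / 25 * s * t * v 5 -
          2 / 25 * s * t * v 6 + (1 - 8 / 25 * s ^ 2 - 12 / 25 * t ^ 2) * v 7 -
          14 / 25 * t * v 10 - 4 / 25 * s * v 11,
        s * v 3 + (1 - 8 / 25 * s ^ 2 - 4 / 25 * t ^ 2) * v 8 - 4 / 25 * s * t * v 9 -
          4 / 25 * s * v 12] := by
  have hd : dens (normalState s t) = 1 := rfl
  have hu : vel (normalState s t) = 0 := by
    ext i
    fin_cases i <;> rfl
  have hs : svec (normalState s t) = ![s, t, 0] := rfl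
  apply state_ext
  · rw [dens_symbol, hd, hu]
    simp [dens, vel, dotProduct, Fin.sum_univ_three]
  · rw [vel_symbol, hd, hu, temp_normalState]
    ext i
    fin_cases i <;> simp [dens, vel, temp]
  · rw [temp_symbol, hd, hu, hs, temp_normalState, fluxMatrix_normalState]
    ext i j
    fin_cases i <;> fin_cases j <;> simp [vel, temp] <;> ring
  · rw [svec_symbol _ _ _ (temp_inv_symm _), hd, hu, hs, temp_normalState, inv_one,
      fluxMatrix_normalState]
    ext i
    simp only [one_mulVec, one_mul]
    simp only [Pi.add_apply, Pi.sub_apply, Pi.smul_apply, smul_eq_mul, mulVec, dotProduct, trace,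
      diag_apply, Fin.sum_univ_three]
    fin_cases i <;> simp [vel, temp, svec] <;> ring

/-- The normal state and the direction `e₁` are invariant under reflection of the third axis, so the
symbol preserves parity. -/
theorem symbol_evenPart (s t : ℝ) (x : Fin 9 → ℝ) :
    symbol (normalState s t) ![1, 0, 0] (evenPart x) = evenPart (evenSymbol s t x) := by
  have e0 : evenPart x 0 = x 0 := rfl
  have e1 : evenPart x 1 = x 1 := rfl
  have e2 : evenPart x 2 = x 2 := rfl
  have e3 : evenPart x 3 = 0 := rfl
  have e4 : evenPart x 4 = x 3 := rfl
  have e5 : evenPart x 5 = x 4 := rfl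
  have e6 : evenPart x 6 = x 5 := rfl
  have e7 : evenPart x 7 = x 6 := rfl
  have e8 : evenPart x 8 = 0 := rfl
  have e9 : evenPart x 9 = 0 := rfl
  have e10 : evenPart x 10 = x 7 := rfl
  have e11 : evenPart x 11 = x 8 := rfl
  have e12 : evenPart x 12 = 0 := rfl
  simp only [symbol_normalState, e0, e1, e2, e3, e4, e5, e6, e7, e8, e9, e10, e11, e12, mul_zero,
    add_zero, sub_zero]
  rfl

theorem symbol_oddPart (s t : ℝ) (x : Fin 4 → ℝ) :
    symbol (normalState s t) ![1, 0, 0] (oddPart x) = oddPart (oddSymbol s t x) := by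
  have e0 : oddPart x 0 = 0 := rfl
  have e1 : oddPart x 1 = 0 := rfl
  have e2 : oddPart x 2 = 0 := rfl
  have e3 : oddPart x 3 = x 0 := rfl
  have e4 : oddPart x 4 = 0 := rfl
  have e5 : oddPart x 5 = 0 := rfl
  have e6 : oddPart x 6 = 0 := rfl
  have e7 : oddPart x 7 = 0 := rfl
  have e8 : oddPart x 8 = x 1 := rfl
  have e9 : oddPart x 9 = x 2 := rfl
  have e10 : oddPart x 10 = 0 := rfl
  have e11 : oddPart x 11 = 0 := rfl
  have e12 : oddPart x 12 = x 3 := rfl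
  simp only [symbol_normalState, e0, e1, e2, e3, e4, e5, e6, e7, e8, e9, e10, e11, e12, mul_zero,
    add_zero, sub_zero]
  rfl

/-! ### Choice of frame and conclusion -/

open scoped MatrixOrder in
/-- A positive definite matrix is of the form `R Rᵀ` with `R` invertible. -/
theorem exists_eq_mul_transpose {Θ : Matrix (Fin 3) (Fin 3) ℝ} (h : Θ.PosDef) :
    ∃ R : Matrix (Fin 3) (Fin 3) ℝ, IsUnit R.det ∧ Θ = R * Rᵀ := by
  obtain ⟨y, hy, rfl⟩ := CStarAlgebra.isStrictlyPositive_iff_eq_star_mul_self.mp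
    h.isStrictlyPositive
  refine ⟨yᵀ, ?_, ?_⟩
  · rw [det_transpose]
    exact (isUnit_iff_isUnit_det y).1 hy
  · rw [transpose_transpose, star_eq_conjTranspose, conjTranspose_eq_transpose_of_trivial]

/-- Two vectors have coordinates of the form `(c, 0, 0)` and `(s, t, 0)` in some orthonormal
frame. -/
theorem exists_orthogonal_frame (x y : Fin 3 → ℝ) :
    ∃ (O : Matrix (Fin 3) (Fin 3) ℝ) (c s t : ℝ), O * Oᵀ = 1 ∧ 0 ≤ s ∧
      Oᵀ *ᵥ x = c • ![1, 0, 0] ∧ Oᵀ *ᵥ y = ![s, t, 0] := by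
  -- Gram–Schmidt on `x, y, 0` gives the zero coordinates by triangularity; the orthonormal-basis
  -- version also covers dependent vectors, so `0` may serve as padding.
  let f : Fin 3 → EuclideanSpace ℝ (Fin 3) := ![WithLp.toLp 2 x, WithLp.toLp 2 y, 0]
  let b := InnerProductSpace.gramSchmidtOrthonormalBasis (𝕜 := ℝ) (by simp) f
  have hb : ∀ i j : Fin 3, i < j → inner ℝ (b j) (f i) = 0 := fun i j hij =>
    InnerProductSpace.gramSchmidtOrthonormalBasis_inv_triangular _ f hij
  let O : Matrix (Fin 3) (Fin 3) ℝ := Matrix.of fun i j => b j i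
  have hO : Oᵀ * O = 1 := by
    ext i j
    have := orthonormal_iff_ite.1 b.orthonormal i j
    rw [PiLp.inner_apply] at this
    rw [one_apply, ← this, mul_apply]
    simp [O, mul_comm]
  have hin : ∀ (j : Fin 3) (z : Fin 3 → ℝ), (Oᵀ *ᵥ z) j = inner ℝ (b j) (WithLp.toLp 2 z) := by
    intro j z
    rw [PiLp.inner_apply]
    simp [mulVec, dotProduct, O, mul_comm]
  have x1 : (Oᵀ *ᵥ x) 1 = 0 := (hin 1 x).trans (hb 0 1 (by decide))
  have x2 : (Oᵀ *ᵥ x) 2 = 0 := (hin 2 x).trans (hb 0 2 (by decide))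
  have y2 : (Oᵀ *ᵥ y) 2 = 0 := (hin 2 y).trans (hb 1 2 (by decide))
  -- Flipping the first axis makes `s ≥ 0`; the sign of `c` is left free.
  obtain ⟨ε, hε, hε0⟩ : ∃ ε : ℝ, ε * ε = 1 ∧ 0 ≤ ε * (Oᵀ *ᵥ y) 0 := by
    rcases le_total 0 ((Oᵀ *ᵥ y) 0) with h | h
    · exact ⟨1, by norm_num, by simpa⟩
    · exact ⟨-1, by norm_num, by simpa⟩
  refine ⟨O * diagonal ![ε, 1, 1], ε * (Oᵀ *ᵥ x) 0, ε * (Oᵀ *ᵥ y) 0, (Oᵀ *ᵥ y) 1, ?_, hε0,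
    ?_, ?_⟩
  · have h1 : diagonal ![ε, 1, 1] * (diagonal ![ε, 1, 1])ᵀ = 1 := by
      rw [diagonal_transpose, diagonal_mul_diagonal, ← diagonal_one]
      congr 1
      ext i
      fin_cases i
      exacts [hε, one_mul 1, one_mul 1]
    rw [transpose_mul, Matrix.mul_assoc, ← Matrix.mul_assoc (diagonal _), h1, Matrix.one_mul]
    exact mul_eq_one_comm.1 hO
  · rw [transpose_mul, diagonal_transpose, ← mulVec_mulVec]
    ext i
    rw [mulVec_diagonal]
    fin_cases i <;> simp [x1, x2]
  · rw [transpose_mul, diagonal_transpose, ← mulVec_mulVec]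
    ext i
    rw [mulVec_diagonal]
    fin_cases i <;> simp [y2]

/-- The directional coefficient matrix acts as the principal symbol. -/
theorem sum_smul_coeffMatrix_mulVec (w : State) (n : Fin 3 → ℝ) (v : State) :
    (∑ k, n k • coeffMatrix w k) *ᵥ v = symbol w n v := by
  rw [symbol, convection_eq_sum_coeffMatrix, sum_mulVec]
  exact Finset.sum_congr rfl fun k _ => by rw [smul_mulVec, mulVec_smul]

theorem realDiagonalizable_of_small {w : State} (hρ : 0 < dens w) (hΘ : (temp w).PosDef)
    (hs : (dens w ^ 2)⁻¹ * (svec w ⬝ᵥ (temp w)⁻¹ *ᵥ svec w) < 1 / 10000) (n : Fin 3 → ℝ) :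
    RealDiagonalizable (∑ k, n k • coeffMatrix w k) := by
  obtain ⟨R, hR, hRΘ⟩ := exists_eq_mul_transpose hΘ
  -- These are the direction and the scaled vector `s` in coordinates where `Θ` is the identity.
  obtain ⟨O, c, s, t, hO, hs0, hx, hy⟩ :=
    exists_orthogonal_frame (Rᵀ *ᵥ n) ((dens w)⁻¹ • R⁻¹ *ᵥ svec w)
  have hOu : IsUnit O.det := by
    refine IsUnit.of_mul_eq_one Oᵀ.det ?_
    rw [← det_mul, hO, det_one]
  have hT : IsUnit (R * O).det := by
    rw [det_mul]
    exact hR.mul hOu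
  have hn : (R * O)ᵀ *ᵥ n = c • ![1, 0, 0] := by
    rw [transpose_mul, ← mulVec_mulVec, hx]
  have hΘT : temp w = (R * O) * temp (normalState s t) * (R * O)ᵀ := by
    rw [temp_normalState, Matrix.mul_one, transpose_mul, Matrix.mul_assoc,
      ← Matrix.mul_assoc O, hO, Matrix.one_mul, hRΘ]
  have hsT : svec w = dens w • (R * O) *ᵥ svec (normalState s t) := by
    change _ = dens w • (R * O) *ᵥ ![s, t, 0]
    rw [← hy, mulVec_mulVec, Matrix.mul_assoc, hO, Matrix.mul_one, mulVec_smul, mulVec_mulVec,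
      mul_nonsing_inv _ hR, one_mulVec, smul_smul, mul_inv_cancel₀ hρ.ne', one_smul]
  have hst : s ^ 2 + t ^ 2 < 1 / 10000 := by
    refine lt_of_eq_of_lt ?_ hs
    rw [hsT, hΘT, inv_conj_frame, temp_normalState, mulVec_smul, smul_dotProduct,
      dotProduct_smul, dotProduct_inv_frame hT, inv_one, one_mulVec]
    change _ = _ * (_ • _ • (![s, t, 0] ⬝ᵥ ![s, t, 0]))
    simp only [smul_eq_mul]
    have := hρ.ne'
    rw [show ![s, t, 0] ⬝ᵥ ![s, t, 0] = s ^ 2 + t ^ 2 by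
      simp [dotProduct, Fin.sum_univ_three]; ring]
    field_simp
  have hs1 : s ≤ 1 / 100 := by nlinarith [sq_nonneg t]
  have ht1 : t ^ 2 ≤ 1 / 100 := by nlinarith [sq_nonneg s]
  have hcov := symbol_transform (w₀ := normalState s t) hρ.ne' hT rfl rfl
    (by ext i; fin_cases i <;> rfl) hΘT hsT hn
  apply realDiagonalizable_of_eigenvectorsSpan
  have key : ∀ v, Matrix.toLin' (∑ k, n k • coeffMatrix w k) v = symbol w n v := fun v => by
    rw [toLin'_apply, sum_smul_coeffMatrix_mulVec]
  have he := range_le_span_eigenvectors _ (Matrix.toLin' (∑ k, n k • coeffMatrix w k))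
    (transform (dens w) (R * O) ∘ₗ evenPart) (vel w ⬝ᵥ n) c
    (fun x => by
      rw [key, LinearMap.comp_apply, LinearMap.comp_apply, hcov, symbol_evenPart]
      simp only [map_add, map_smul])
    (evenSymbol_eigenvectorsSpan hs0 hs1 ht1)
  have ho := range_le_span_eigenvectors _ (Matrix.toLin' (∑ k, n k • coeffMatrix w k))
    (transform (dens w) (R * O) ∘ₗ oddPart) (vel w ⬝ᵥ n) c
    (fun x => by
      rw [key, LinearMap.comp_apply, LinearMap.comp_apply, hcov, symbol_oddPart]
      simp only [map_add, map_smul])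
    (oddSymbol_eigenvectorsSpan hs0 hs1 ht1)
  rw [EigenvectorsSpan, eq_top_iff]
  intro v _
  -- Every state is the image of an even plus an odd perturbation, and both images lie in the span
  -- of eigenvectors.
  obtain ⟨v, rfl⟩ := transform_surjective hρ.ne' hT v
  rw [← evenPart_add_oddPart v, map_add]
  exact add_mem (he ⟨_, rfl⟩) (ho ⟨_, rfl⟩)

end ThirteenMoment

end

theorem theorem4p2 :
    ∃ δ : ℝ, 0 < δ ∧
      ∀ w : ThirteenMoment.State,
        0 < ThirteenMoment.dens w →
        (ThirteenMoment.temp w).PosDef →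
        (ThirteenMoment.dens w ^ 2)⁻¹ *
            (ThirteenMoment.svec w ⬝ᵥ
              (ThirteenMoment.temp w)⁻¹ *ᵥ ThirteenMoment.svec w) < δ →
        ThirteenMoment.IsHyperbolic (ThirteenMoment.coeffMatrix w) :=
  ⟨1 / 10000, by norm_num, fun _ hρ hΘ hs n _ =>
    ThirteenMoment.realDiagonalizable_of_small hρ hΘ hs n⟩
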